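/- **Theorem.** Let $k\ge 2$ and $\alpha=(\alpha_1,\dots,\alpha_k)\in(0,\infty)^k$, and put $\alpha_0=\sum_{i=1}^k\alpha_i$. Let $X_1,X_2,\dots$ be i.i.d. random vectors with the Dirichlet distribution $\mathcal D_k(\alpha)$, i.e. the probability distribution on the open simplex $S=\{x\in(0,1)^k:\sum_i x_i=1\}$ whose first $k-1$ coordinates have density $\frac{\Gamma(\alpha_0)}{\prod_i\Gamma(\alpha_i)}\prod_{i=1}^k x_i^{\alpha_i-1}$ (with $x_k=1-\sum_{i<k}x_i$) with respect to Lebesgue measure on $\mathbb R^{k-1}$. Write $\overline{f(X)}=\frac1n\sum_{t=1}^n f(X_t)$, let $\psi=(\log\Gamma)'$ be the digamma function, and let $\Psi(a,b)=\psi(a)-\psi(b)$. The score-adjusted moment estimator of $\alpha$ from the sample $X_1,\dots,X_n$ is $$\breve\alpha_{i}=\frac{(k-1)\,\overline{X_i}}{\sum_{j=1}^k\left[\,\overline{X_j\log X_j}-\overline{X_j}\;\overline{\log X_j}\,\right]},\qquad i=1,\dots,k,$$ where $X_i$ denotes the $i$-th coordinate. Let $$h(x)=(x_1,\dots,x_k,\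 \log x_1,\dots,\log x_k,\ x_1\log x_1,\dots,x_k\log x_k),\qquad g_i(y)=\frac{(k-1)\,y_i}{\sum_{j=1}^k(y_{2k+j}-y_jy_{k+j})},\quad i=1,\dots,k,$$ and $e_h(\theta)=\mathbb E_\theta[h(X)]$ for $X\sim\mathcal D_k(\theta)$, $\theta\in(0,\infty)^k$. 1. $\breve\alpha$ is a moment-type estimator with the functions $h$ and $g$: the expectation $e_h(\theta)$ exists for every $\theta\in(0,\infty)^k$, $e_h$ is injective on $(0,\infty)^k$, $g(e_h(\theta))=\theta$ for every $\theta\in(0,\infty)^k$, and $\breve\alpha=g\big(\overline{h(X)}\big)$. 2. $h(X)$ is square integrable for $X\sim\mathcal D_k(\alpha)$, and $g$ is continuously differentiable at $\mu=e_h(\alpha)$. Its Jacobian matrix at $\mu$ is the $k\times 3k$ block matrix $G=[\,G_1\ G_2\ G_3\,]$ with, for $i,j\in\{1,\dots,k\}$, $$(G_1)_{ij}=\frac{\alpha_0\alpha_i}{k-1}\Psi(\alpha_j,\alpha_0)+\alpha_0\mathbb I_{\{i=j\}},\qquad (G_2)_{ij}=\frac{\alpha_i\alpha_j}{k-1},\qquad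 (G_3)_{ij}=-\frac{\alpha_0\alpha_i}{k-1}.$$ 3. As $n\to\infty$, the probability that $\breve\alpha\in(0,\infty)^k$ tends to $1$, and $$\sqrt n\,(\breve\alpha-\alpha)\ \xrightarrow{\ \mathcal L\ }\ \mathcal N_k\big(0,\ G V G^\top\big),$$ where $V$ is the variance-covariance matrix of $h(X)$, $X\sim\mathcal D_k(\alpha)$. -/

import Mathlib

open MeasureTheory ProbabilityTheory Filter Topology

noncomputable section

namespace MomentEst

/-! ### Moment-type estimators -/

/-- The arithmetic mean of a finite sample of vectors (or of real numbers). -/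
def sampleMean {E : Type*} [AddCommGroup E] [Module ℝ E] {n : ℕ} (x : Fin n → E) : E :=
  (n : ℝ)⁻¹ • ∑ t, x t

/-- The moment map `e_h(θ) = E_θ[h(X)]` of a parametric family `D`. -/
def momentMap {ι κ δ : Type*} [Fintype ι] (D : (δ → ℝ) → Measure (κ → ℝ))
    (h : (κ → ℝ) → (ι → ℝ)) (θ : δ → ℝ) : ι → ℝ :=
  ∫ x, h x ∂(D θ)

/-- The variance-covariance matrix `v_h(θ)` of the random vector `h(X)`, `X ∼ D θ`. -/
def momentCov {ι κ δ : Type*} (D : (δ → ℝ) → Measure (κ → ℝ))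
    (h : (κ → ℝ) → (ι → ℝ)) (θ : δ → ℝ) : Matrix ι ι ℝ :=
  Matrix.of fun a b => cov[fun x => h x a, fun x => h x b; D θ]

/-- `est` (a family of functions of samples of each size) is a moment-type estimator, with functions
`h` and `g`, of the parameter of the family `D` of probability distributions, with support `S` and
parameter space `Θ`. Only the values of `h` on `S` matter. -/
structure IsMomentTypeEstimator {ι κ δ : Type*} [Fintype ι]
    (Θ : Set (δ → ℝ)) (S : Set (κ → ℝ)) (D : (δ → ℝ) → Measure (κ → ℝ))
    (h : (κ → ℝ) → (ι → ℝ)) (g : (ι → ℝ) → (δ → ℝ))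
    (est : (n : ℕ) → (Fin n → κ → ℝ) → (δ → ℝ)) : Prop where
  /-- every member of the family is a probability measure -/
  isProbabilityMeasure : ∀ θ ∈ Θ, IsProbabilityMeasure (D θ)
  /-- every member of the family is carried by `S` -/
  measure_compl_support : ∀ θ ∈ Θ, D θ Sᶜ = 0
  /-- the moments `e_h(θ)` exist -/
  integrable : ∀ θ ∈ Θ, Integrable h (D θ)
  /-- `e_h` is injective on the parameter space -/
  injOn : Set.InjOn (momentMap D h) Θ
  /-- `g` restricted to `e_h(Θ)` is the inverse of `e_h` -/
  leftInvOn : Set.LeftInvOn g (momentMap D h) Θ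
  /-- the estimator is `g` evaluated at the sample mean of `h` -/
  estimator_eq : ∀ n : ℕ, 0 < n → ∀ x : Fin n → κ → ℝ, (∀ t, x t ∈ S) →
    est n x = g (sampleMean fun t => h (x t))

/-! ### The digamma function -/

/-- The digamma function `ψ`, the derivative of `log Γ` (used at positive arguments only). -/
def digamma (a : ℝ) : ℝ := deriv (fun t : ℝ => Real.log (Real.Gamma t)) a

/-- The digamma difference `Ψ(a, b) = ψ(a) - ψ(b)`. -/
def digammaDiff (a b : ℝ) : ℝ := digamma a - digamma b

/-! ### The Dirichlet distribution -/

/-- The open standard `(k-1)`-dimensional simplex in `ℝ^k`. -/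
def openSimplex (k : ℕ) : Set (Fin k → ℝ) :=
  {x | (∀ i, x i ∈ Set.Ioo (0 : ℝ) 1) ∧ ∑ i, x i = 1}

/-- The parameter space `(0, ∞)^k`. -/
def posOrthant (k : ℕ) : Set (Fin k → ℝ) := {α | ∀ i, 0 < α i}

/-- The Dirichlet density. -/
def dirichletPDF {k : ℕ} (α x : Fin k → ℝ) : ENNReal :=
  (openSimplex k).indicator
    (fun x => ENNReal.ofReal
      (Real.Gamma (∑ i, α i) / (∏ i, Real.Gamma (α i)) * ∏ i, x i ^ (α i - 1))) x

/-- The point of the hyperplane `∑ x_i = 1` of `ℝ^k` with prescribed first `k - 1` coordinates. -/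
def completeSimplex {k : ℕ} (y : Fin (k - 1) → ℝ) : Fin k → ℝ :=
  fun i => if hi : (i : ℕ) < k - 1 then y ⟨i, hi⟩ else 1 - ∑ j, y j

theorem measurable_completeSimplex {k : ℕ} :
    Measurable (completeSimplex : (Fin (k - 1) → ℝ) → Fin k → ℝ) := by
  refine measurable_pi_lambda _ fun i => ?_
  unfold completeSimplex
  split_ifs <;> fun_prop

/-- The Dirichlet distribution on `ℝ^k`: the first `k - 1` coordinates have the Dirichlet density
with respect to Lebesgue measure on `ℝ^(k-1)`, and the last one makes the sum equal to `1`. -/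
def dirichletMeasure {k : ℕ} (α : Fin k → ℝ) : Measure (Fin k → ℝ) :=
  ((volume : Measure (Fin (k - 1) → ℝ)).withDensity
    fun y => dirichletPDF α (completeSimplex y)).map completeSimplex

/-! ### The score-adjusted moment estimator -/

/-- The score-adjusted moment estimator, as a function of a sample of size `n`. -/
def sameEstimator {k : ℕ} (n : ℕ) (x : Fin n → Fin k → ℝ) : Fin k → ℝ :=
  fun i => ((k : ℝ) - 1) * sampleMean (fun t => x t i) /
    ∑ j, (sampleMean (fun t => x t j * Real.log (x t j))
      - sampleMean (fun t => x t j) * sampleMean (fun t => Real.log (x t j)))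

/-- `h(x) = (x_1, …, x_k, log x_1, …, log x_k, x_1 log x_1, …, x_k log x_k)`. The `3k` coordinates
are indexed by three consecutive blocks of size `k`. -/
def sameH {k : ℕ} (x : Fin k → ℝ) : Fin k ⊕ Fin k ⊕ Fin k → ℝ :=
  Sum.elim (fun i => x i)
    (Sum.elim (fun i => Real.log (x i)) (fun i => x i * Real.log (x i)))

/-- `g_i(y) = (k-1) y_i / ∑_j (y_{2k+j} - y_j y_{k+j})`. -/
def sameG {k : ℕ} (y : Fin k ⊕ Fin k ⊕ Fin k → ℝ) : Fin k → ℝ :=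
  fun i => ((k : ℝ) - 1) * y (.inl i) /
    ∑ j, (y (.inr (.inr j)) - y (.inl j) * y (.inr (.inl j)))

/-- The explicit `k × 3k` block matrix `G = [G₁ G₂ G₃]`. -/
def sameJacobian {k : ℕ} (α : Fin k → ℝ) : Matrix (Fin k) (Fin k ⊕ Fin k ⊕ Fin k) ℝ :=
  Matrix.fromCols
    (Matrix.of fun i j => (∑ l, α l) * α i / ((k : ℝ) - 1) * digammaDiff (α j) (∑ l, α l)
      + if i = j then ∑ l, α l else 0)
    (Matrix.fromCols
      (Matrix.of fun i j => α i * α j / ((k : ℝ) - 1))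
      (Matrix.of fun i _ => -((∑ l, α l) * α i / ((k : ℝ) - 1))))

end MomentEst

end

/-! The estimator rests on the identity Cov(X_j, log X_j) = 1/α₀ - α_j/α₀² for Dirichlet vectors, in
which no digamma value survives. Summed over j it gives (k-1)/α₀, and dividing (k-1) E[X_i] = (k-1)
α_i/α₀ by this returns α_i. So g is a left inverse of e_h, which also makes e_h injective.

The identity comes from the Dirichlet integral (`Gamma_mul_lintegral_prod_posPow`). Multiplying the
unnormalised density by x_j^s only shifts α_j to α_j + s (`prod_posPow_mul_exp_log`), so the moment
generating function of log X_j is a ratio of normalising constants, a product of Gamma values. Its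
value at 1 is E[X_j]; its derivatives at 0 and 1 are E[log X_j] and E[X_j log X_j]
(`integral_log_mul_exp_log_dirichletMeasure`); ψ(a+1) = ψ(a) + 1/a then cancels the digamma terms
(`sameDenom_momentMap`). Finiteness of this function near 0 gives square integrability of h(X).

The asymptotics need only that g is differentiable at μ (`hasFDerivAt_sameG`, the quotient rule) and
that h(X) is square integrable. The strong law gives consistency; the central limit theorem, reduced
to the real line through characteristic functions, and the delta method
(`tendstoInDistribution_delta_method`) give the Gaussian limit. -/

/-! ### The multivariate central limit theorem and the delta method -/

namespace ProbabilityTheory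

open scoped RealInnerProductSpace

variable {Ω : Type*} {mΩ : MeasurableSpace Ω} {P : Measure Ω} {ι κ : Type*} [Fintype ι] [Fintype κ]

/-- The covariance matrix of the coordinates of a random vector. -/
noncomputable def covMatrix (Y : Ω → EuclideanSpace ℝ ι) (P : Measure Ω) : Matrix ι ι ℝ :=
  Matrix.of fun a b => cov[fun ω => Y ω a, fun ω => Y ω b; P]

lemma memLp_euclidean_apply {Y : Ω → EuclideanSpace ℝ ι} {p : ENNReal} (hY : MemLp Y p P) (i : ι) :
    MemLp (fun ω => Y ω i) p P :=
  (EuclideanSpace.proj (𝕜 := ℝ) i).comp_memLp' hY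

/-- Bilinearity of covariance. This matches the variance of each scalar projection with the
quadratic form in the Gaussian characteristic function. -/
lemma variance_inner_eq_covMatrix [IsFiniteMeasure P] {Y : Ω → EuclideanSpace ℝ ι}
    (hY : MemLp Y 2 P) (t : EuclideanSpace ℝ ι) :
    Var[fun ω => ⟪Y ω, t⟫; P] = t.ofLp ⬝ᵥ (covMatrix Y P).mulVec t.ofLp := by
  have h1 : (fun ω => ⟪Y ω, t⟫) = fun ω => ∑ i, t i * Y ω i := by
    ext ω; simp [PiLp.inner_apply]
  rw [h1, ← covariance_self, covariance_fun_sum_fun_sum]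
  · simp only [dotProduct, Matrix.mulVec, covMatrix, Matrix.of_apply, covariance_const_mul_left,
      covariance_const_mul_right, Finset.mul_sum]
    exact Finset.sum_congr rfl fun i _ => Finset.sum_congr rfl fun j _ => by ring
  · exact fun i => (memLp_euclidean_apply hY i).const_mul _
  · exact fun i => (memLp_euclidean_apply hY i).const_mul _
  · exact (Finset.aemeasurable_fun_sum _ fun i _ =>
      (memLp_euclidean_apply hY i).aestronglyMeasurable.aemeasurable.const_mul _)

lemma posSemidef_covMatrix [IsFiniteMeasure P] {Y : Ω → EuclideanSpace ℝ ι} (hY : MemLp Y 2 P) :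
    (covMatrix Y P).PosSemidef := by
  refine Matrix.PosSemidef.of_dotProduct_mulVec_nonneg ?_ fun x => ?_
  · ext a b
    simp [covMatrix, covariance_comm]
  · have := variance_inner_eq_covMatrix hY (WithLp.toLp 2 x)
    simp only [star_trivial]
    rw [← this]
    exact variance_nonneg _ _

/-- **Central limit theorem** in Euclidean space. -/
theorem tendstoInDistribution_inv_sqrt_smul_sum_sub [DecidableEq ι] [IsProbabilityMeasure P]
    {Y : ℕ → Ω → EuclideanSpace ℝ ι} (hY : MemLp (Y 0) 2 P) (hindep : iIndepFun Y P)
    (hident : ∀ i, IdentDistrib (Y i) (Y 0) P P) :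
    TendstoInDistribution
      (fun (n : ℕ) ω => (√n)⁻¹ • (∑ i ∈ Finset.range n, Y i ω - (n : ℝ) • P[Y 0])) atTop
      (id : EuclideanSpace ℝ ι → EuclideanSpace ℝ ι) (fun _ => P)
      (multivariateGaussian 0 (covMatrix (Y 0) P)) where
  forall_aemeasurable n := by
    have h := Finset.aemeasurable_fun_sum (Finset.range n) fun i _ => (hident i).aemeasurable_fst
    fun_prop
  tendsto := by
    refine ProbabilityMeasure.tendsto_iff_tendsto_charFun.2 fun t => ?_
    have hmeas : ∀ i, AEMeasurable (Y i) P := fun i => (hident i).aemeasurable_fst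
    have hL : Measurable fun y : EuclideanSpace ℝ ι => ⟪y, t⟫ := by fun_prop
    have h1 := tendstoInDistribution_inv_sqrt_mul_sum_sub (P := P)
      (X := fun i ω => ⟪Y i ω, t⟫) (Y := id)
      (P' := gaussianReal 0 Var[fun ω => ⟪Y 0 ω, t⟫; P].toNNReal)
      ⟨aemeasurable_id, Measure.map_id⟩ ?_ (hindep.comp (fun _ y => ⟪y, t⟫) fun _ => hL)
      (fun i => (hident i).comp hL)
    -- Cramér–Wold: the characteristic function of a vector at `t` is that of its projection on `t`
    -- at 1, so the scalar theorem is only used at frequency 1.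
    · have h2 := ProbabilityMeasure.tendsto_iff_tendsto_charFun.1 h1.tendsto 1
      have hpos := posSemidef_covMatrix hY
      convert! h2 using 1
      · ext n
        simp only [ProbabilityMeasure.coe_mk]
        rw [charFun_apply, charFun_apply, integral_map, integral_map]
        · refine integral_congr_ae (ae_of_all _ fun ω => ?_)
          have hint : ∫ ω, ⟪Y 0 ω, t⟫ ∂P = ⟪P[Y 0], t⟫ := by
            have := integral_inner (𝕜 := ℝ) (hY.integrable (by norm_num)) t
            rw [real_inner_comm, ← this]
            exact integral_congr_ae (ae_of_all _ fun ω => real_inner_comm _ _)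
          simp only [hint]
          simp [real_inner_smul_left, inner_sub_left, sum_inner]
        · fun_prop
        · fun_prop
        · fun_prop
        · fun_prop
      · simp only [ProbabilityMeasure.coe_mk, Measure.map_id]
        rw [charFun_multivariateGaussian hpos, charFun_gaussianReal,
          ← variance_inner_eq_covMatrix hY]
        congr 2
        simp [Real.coe_toNNReal _ (variance_nonneg _ _)]
    · exact MemLp.inner_const (𝕜 := ℝ) hY t

/-- **Delta method**. -/
theorem tendstoInDistribution_delta_method {E F Ω' : Type*} [NormedAddCommGroup E]
    [NormedSpace ℝ E] [MeasurableSpace E] [BorelSpace E] [SecondCountableTopology E]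
    [NormedAddCommGroup F] [NormedSpace ℝ F] [MeasurableSpace F] [BorelSpace F]
    [SecondCountableTopology F] {mΩ' : MeasurableSpace Ω'} {P' : Measure Ω'}
    [IsProbabilityMeasure P] [IsProbabilityMeasure P'] {T : ℕ → Ω → E} {Z : Ω' → E} {m : E}
    {r : ℕ → ℝ} (hr : ∀ n, 0 ≤ r n) {g : E → F} {G : E →L[ℝ] F}
    (hZ : TendstoInDistribution (fun n ω => r n • (T n ω - m)) atTop Z (fun _ => P) P')
    (hTm : ∀ n, AEMeasurable (T n) P) (hT : ∀ᵐ ω ∂P, Tendsto (fun n => T n ω) atTop (𝓝 m))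
    (hgm : Measurable g) (hg : HasFDerivAt g G m) :
    TendstoInDistribution (fun n ω => r n • (g (T n ω) - g m)) atTop (fun ω => G (Z ω))
      (fun _ => P) P' := by
  -- The normalised Taylor remainder. At `y = m` the inverse of 0 is 0, so `e m = 0` and `e` is
  -- continuous at `m`.
  set e : E → F := fun y => ‖y - m‖⁻¹ • (g y - g m - G (y - m)) with he
  have he_meas : Measurable e := by fun_prop
  have he_lim : Tendsto e (𝓝 m) (𝓝 0) := by
    rw [tendsto_zero_iff_norm_tendsto_zero]
    refine (hasFDerivAt_iff_tendsto.1 hg).congr fun y => ?_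
    rw [he, norm_smul, norm_inv, norm_norm]
  have hem : ∀ n, AEMeasurable (fun ω => e (T n ω)) P := fun n =>
    he_meas.comp_aemeasurable (hTm n)
  have hconv : TendstoInMeasure P (fun n ω => e (T n ω)) atTop fun _ => 0 := by
    refine tendstoInMeasure_of_tendsto_ae (fun n => (hem n).aestronglyMeasurable) ?_
    filter_upwards [hT] with ω hω using he_lim.comp hω
  -- Slutsky: with p = (r (T - m), e(T)), this map returns r (g(T) - g(m)) exactly. The second
  -- component tends to 0 in probability, so only G survives in the limit.
  have hc : Continuous fun p : E × F => G p.1 + ‖p.1‖ • p.2 := by fun_prop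
  have := hZ.continuous_comp_prodMk_of_tendstoInMeasure_const hc hconv hem
  refine this.congr (fun n => ae_of_all _ fun ω => ?_) (ae_of_all _ fun ω => by simp)
  rcases eq_or_ne (T n ω) m with h | h
  · simp [h]
  · have h0 : ‖T n ω - m‖ ≠ 0 := norm_ne_zero_iff.2 (sub_ne_zero.2 h)
    simp only [he, norm_smul, Real.norm_of_nonneg (hr n), smul_smul, mul_assoc,
      mul_inv_cancel₀ h0, mul_one, map_smul, ← smul_add]
    congr 1
    abel

/-- Moving A across the inner product evaluates the characteristic function of S at Aᵀt, and the
quadratic form of S there is that of A S Aᵀ at t. -/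
lemma map_multivariateGaussian_zero [DecidableEq ι] [DecidableEq κ] {S : Matrix ι ι ℝ}
    (hS : S.PosSemidef) (A : Matrix κ ι ℝ) (L : EuclideanSpace ℝ ι →L[ℝ] EuclideanSpace ℝ κ)
    (hL : ∀ x, (L x).ofLp = A.mulVec x.ofLp) :
    (multivariateGaussian 0 S).map L = multivariateGaussian 0 (A * S * A.transpose) := by
  have hS' : (A * S * A.transpose).PosSemidef := by
    simpa using hS.mul_mul_conjTranspose_same A
  refine Measure.ext_of_charFun (funext fun t => ?_)
  have h : charFun ((multivariateGaussian 0 S).map L) t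
      = charFun (multivariateGaussian 0 S) (WithLp.toLp 2 (A.transpose.mulVec t.ofLp)) := by
    rw [charFun_apply, charFun_apply, integral_map (by fun_prop) (by fun_prop)]
    congr 1
    ext x
    have : ⟪L x, t⟫ = ⟪x, WithLp.toLp 2 (A.transpose.mulVec t.ofLp)⟫ := by
      rw [EuclideanSpace.inner_eq_star_dotProduct, EuclideanSpace.inner_eq_star_dotProduct]
      simp only [star_trivial, hL, Matrix.mulVec_transpose]
      rw [Matrix.dotProduct_mulVec]
    rw [this]
  rw [h, charFun_multivariateGaussian hS, charFun_multivariateGaussian hS']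
  have h2 : A.transpose.mulVec t.ofLp ⬝ᵥ S.mulVec (A.transpose.mulVec t.ofLp)
      = t.ofLp ⬝ᵥ (A * S * A.transpose).mulVec t.ofLp := by
    rw [← Matrix.mulVec_mulVec, ← Matrix.mulVec_mulVec, Matrix.dotProduct_mulVec t.ofLp,
      Matrix.mulVec_transpose]
  simp only [inner_zero_right, h2]

end ProbabilityTheory

/-! ### The Dirichlet integral -/

namespace MomentEst

lemma lintegral_fin_prod_eq_prod {n : ℕ} (f : Fin n → ℝ → ENNReal) (hf : ∀ i, Measurable (f i)) :
    ∫⁻ x : Fin n → ℝ, ∏ i, f i (x i) = ∏ i, ∫⁻ u, f i u := by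
  induction n with
  | zero => simp [volume_pi]
  | succ n ih =>
    have e := (volume_preserving_piFinSuccAbove (fun _ : Fin (n + 1) => ℝ) 0).symm
    rw [← e.lintegral_comp (by fun_prop)]
    simp only [Fin.prod_univ_succ, MeasurableEquiv.piFinSuccAbove_symm_apply, Fin.insertNthEquiv_zero,
      Fin.consEquiv_apply, Fin.cons_zero, Fin.cons_succ, Measure.volume_eq_prod]
    rw [lintegral_prod_mul (f := fun u => f 0 u) (g := fun x : Fin n → ℝ => ∏ i, f i.succ (x i))
      (hf 0).aemeasurable
      (Finset.measurable_fun_prod _ fun i _ => (hf _).comp (measurable_pi_apply i)).aemeasurable,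
      ih _ fun i => hf _]

/-- The power `u ^ (a - 1)`, extended by zero to `u ≤ 0`. -/
noncomputable def posPow (a u : ℝ) : ENNReal :=
  (Set.Ioi (0 : ℝ)).indicator (fun u => ENNReal.ofReal (u ^ (a - 1))) u

lemma measurable_posPow (a : ℝ) : Measurable (posPow a) :=
  Measurable.indicator (by fun_prop) measurableSet_Ioi

lemma posPow_of_pos {a u : ℝ} (hu : 0 < u) : posPow a u = ENNReal.ofReal (u ^ (a - 1)) :=
  Set.indicator_of_mem (by simpa using hu) _

lemma posPow_of_nonpos {a u : ℝ} (hu : u ≤ 0) : posPow a u = 0 :=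
  Set.indicator_of_notMem (by simpa using hu) _

lemma lintegral_posPow_mul_exp {a : ℝ} (ha : 0 < a) :
    ∫⁻ u, posPow a u * ENNReal.ofReal (Real.exp (-u)) = ENNReal.ofReal (Real.Gamma a) := by
  rw [Real.Gamma_eq_integral ha, ofReal_integral_eq_lintegral_ofReal
    (Real.GammaIntegral_convergent ha), ← lintegral_indicator measurableSet_Ioi]
  · congr 1
    ext u
    by_cases hu : 0 < u
    · rw [posPow_of_pos hu, Set.indicator_of_mem (by simpa using hu), ← ENNReal.ofReal_mul
        (by positivity), mul_comm]
    · rw [posPow_of_nonpos (not_lt.1 hu), Set.indicator_of_notMem (by simpa using hu), zero_mul]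
  · filter_upwards [ae_restrict_mem measurableSet_Ioi] with u hu
    have : (0 : ℝ) < u := hu
    positivity

lemma prod_posPow_of_nonpos {k : ℕ} (α : Fin k → ℝ) {x : Fin k → ℝ} {i : Fin k} (hi : x i ≤ 0) :
    ∏ i, posPow (α i) (x i) = 0 :=
  Finset.prod_eq_zero (Finset.mem_univ i) (posPow_of_nonpos hi)

lemma prod_posPow_of_pos {k : ℕ} (α : Fin k → ℝ) {x : Fin k → ℝ} (hx : ∀ i, 0 < x i) :
    ∏ i, posPow (α i) (x i) = ENNReal.ofReal (∏ i, x i ^ (α i - 1)) := by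
  rw [ENNReal.ofReal_prod_of_nonneg fun i _ => Real.rpow_nonneg (hx i).le _]
  exact Finset.prod_congr rfl fun i _ => posPow_of_pos (hx i)

/-- Homogeneity of degree ∑ α_i - k. It needs no sign condition on x: a nonpositive coordinate kills
both sides. -/
lemma prod_posPow_smul {k : ℕ} (α x : Fin k → ℝ) {s : ℝ} (hs : 0 < s) :
    ∏ i, posPow (α i) (s * x i)
      = ENNReal.ofReal (s ^ ((∑ i, α i) - k)) * ∏ i, posPow (α i) (x i) := by
  have h : ∀ i, posPow (α i) (s * x i) = ENNReal.ofReal (s ^ (α i - 1)) * posPow (α i) (x i) := by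
    intro i
    rcases lt_or_ge 0 (x i) with h | h
    · rw [posPow_of_pos h, posPow_of_pos (mul_pos hs h), Real.mul_rpow hs.le h.le,
        ENNReal.ofReal_mul (by positivity)]
    · rw [posPow_of_nonpos h, posPow_of_nonpos (mul_nonpos_of_nonneg_of_nonpos hs.le h), mul_zero]
  simp only [h, Finset.prod_mul_distrib]
  rw [← ENNReal.ofReal_prod_of_nonneg fun i _ => by positivity, ← Real.rpow_sum_of_pos hs]
  simp

lemma lintegral_smul_pi {m : ℕ} {f : (Fin m → ℝ) → ENNReal} (hf : Measurable f) {s : ℝ}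
    (hs : 0 < s) : ∫⁻ y, f y = ENNReal.ofReal (s ^ m) * ∫⁻ y, f (s • y) := by
  rw [← lintegral_map hf (measurable_const_smul s), Measure.map_addHaar_smul _ hs.ne',
    lintegral_smul_measure, smul_eq_mul, ← mul_assoc, ← ENNReal.ofReal_mul (by positivity),
    Module.finrank_fin_fun, abs_of_pos (by positivity), mul_inv_cancel₀ (by positivity)]
  simp

lemma measurable_prod_posPow_snoc {m : ℕ} (α : Fin (m + 1) → ℝ) {β : Type*} [MeasurableSpace β]
    {u : β → ℝ} {y : β → Fin m → ℝ} (hu : Measurable u) (hy : Measurable y) :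
    Measurable fun b => ∏ i, posPow (α i) (Fin.snoc (α := fun _ => ℝ) (y b) (u b) i) := by
  refine Finset.measurable_fun_prod _ fun i _ => (measurable_posPow _).comp ?_
  refine Fin.lastCases ?_ (fun j => ?_) i
  · simpa using hu
  · simpa [Function.comp_def] using (measurable_pi_apply j).comp hy

/-- The Dirichlet integral. -/
theorem Gamma_mul_lintegral_prod_posPow {m : ℕ} {α : Fin (m + 1) → ℝ} (hα : ∀ i, 0 < α i) :
    ENNReal.ofReal (Real.Gamma (∑ i, α i))
      * ∫⁻ y : Fin m → ℝ, ∏ i, posPow (α i) (Fin.snoc (α := fun _ => ℝ) y (1 - ∑ j, y j) i)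
      = ∏ i, ENNReal.ofReal (Real.Gamma (α i)) := by
  set D := ∫⁻ y : Fin m → ℝ, ∏ i, posPow (α i) (Fin.snoc (α := fun _ => ℝ) y (1 - ∑ j, y j) i)
    with hD
  have hexp : Measurable fun s : ℝ => ENNReal.ofReal (Real.exp (-s)) := by fun_prop
  have hf : ∀ a, Measurable fun u : ℝ => posPow a u * ENNReal.ofReal (Real.exp (-u)) :=
    fun a => (measurable_posPow a).mul hexp
  have hsnoc : ∀ s : ℝ, Measurable fun y : Fin m → ℝ =>
      ∏ i, posPow (α i) (Fin.snoc (α := fun _ => ℝ) y (s - ∑ j, y j) i) :=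
    fun s => measurable_prod_posPow_snoc α (by fun_prop) measurable_id
  have hα0 : 0 < ∑ i, α i := Finset.sum_pos (fun i _ => hα i) Finset.univ_nonempty
  -- The slice of total mass s. Scaling y by s contributes s^m and homogeneity s^(α₀ - (m+1)),
  -- together s^(α₀ - 1), the Gamma integrand. For s ≤ 0 no point of the slice has all coordinates
  -- positive.
  have key : ∀ s : ℝ, ∫⁻ y : Fin m → ℝ,
      (∏ i, posPow (α i) (Fin.snoc (α := fun _ => ℝ) y (s - ∑ j, y j) i))
        * ENNReal.ofReal (Real.exp (-s))
      = posPow (∑ i, α i) s * ENNReal.ofReal (Real.exp (-s)) * D := by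
    intro s
    rw [lintegral_mul_const _ (hsnoc s),
      mul_right_comm]
    congr 1
    rcases lt_or_ge 0 s with hs | hs
    · rw [lintegral_smul_pi (hsnoc s) hs]
      have h : ∀ y : Fin m → ℝ,
          ∏ i, posPow (α i) (Fin.snoc (α := fun _ => ℝ) (s • y) (s - ∑ j, (s • y) j) i)
          = ENNReal.ofReal (s ^ ((∑ i, α i) - (m + 1 : ℕ)))
            * ∏ i, posPow (α i) (Fin.snoc (α := fun _ => ℝ) y (1 - ∑ j, y j) i) := by
        intro y
        rw [← prod_posPow_smul _ _ hs]
        refine Finset.prod_congr rfl fun i _ => ?_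
        congr 1
        refine Fin.lastCases ?_ (fun j => ?_) i
        · simp [mul_sub, Finset.mul_sum]
        · simp
      simp only [h]
      rw [lintegral_const_mul _ (hsnoc 1), ← mul_assoc,
        ← ENNReal.ofReal_mul (by positivity), posPow_of_pos hs, ← Real.rpow_natCast,
        ← Real.rpow_add hs]
      congr 3
      push_cast
      ring
    · rw [posPow_of_nonpos hs, zero_mul]
      refine (lintegral_congr fun y => ?_).trans lintegral_zero
      by_cases hy : ∃ j, y j ≤ 0
      · obtain ⟨j, hj⟩ := hy
        exact prod_posPow_of_nonpos α (i := j.castSucc) (by simpa using hj)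
      · push Not at hy
        refine prod_posPow_of_nonpos α (i := Fin.last m) ?_
        have := Finset.sum_nonneg fun j (_ : j ∈ Finset.univ) => (hy j).le
        simp only [Fin.snoc_last]
        linarith
  calc ENNReal.ofReal (Real.Gamma (∑ i, α i)) * D
      = ∫⁻ s : ℝ, posPow (∑ i, α i) s * ENNReal.ofReal (Real.exp (-s)) * D := by
        rw [lintegral_mul_const _ (hf _), lintegral_posPow_mul_exp hα0]
    _ = ∫⁻ s : ℝ, ∫⁻ y : Fin m → ℝ,
          (∏ i, posPow (α i) (Fin.snoc (α := fun _ => ℝ) y (s - ∑ j, y j) i))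
            * ENNReal.ofReal (Real.exp (-s)) := lintegral_congr fun s => (key s).symm
    _ = ∫⁻ y : Fin m → ℝ, ∫⁻ s : ℝ,
          (∏ i, posPow (α i) (Fin.snoc (α := fun _ => ℝ) y (s - ∑ j, y j) i))
            * ENNReal.ofReal (Real.exp (-s)) :=
        lintegral_lintegral_swap (((measurable_prod_posPow_snoc α (by fun_prop)
          measurable_snd).mul (hexp.comp measurable_fst)).aemeasurable)
    _ = ∫⁻ y : Fin m → ℝ, (∏ j, posPow (α j.castSucc) (y j) * ENNReal.ofReal (Real.exp (-y j)))
          * ENNReal.ofReal (Real.Gamma (α (Fin.last m))) := by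
        refine lintegral_congr fun y => ?_
        rw [← lintegral_posPow_mul_exp (hα _), ← lintegral_const_mul _ (hf _)]
        -- Translating by ∑ y_j turns the last coordinate into s - ∑ y_j; the exponentials then
        -- combine to exp(-s), so slicing by total mass agrees with a product of independent Gamma
        -- integrals.
        conv_rhs => rw [← lintegral_sub_right_eq_self _ (∑ j, y j)]
        refine lintegral_congr fun s => ?_
        simp only [Fin.prod_univ_castSucc, Fin.snoc_castSucc, Fin.snoc_last,
          Finset.prod_mul_distrib]
        rw [← ENNReal.ofReal_prod_of_nonneg fun _ _ => (Real.exp_pos _).le, ← Real.exp_sum,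
          mul_mul_mul_comm, ← ENNReal.ofReal_mul (Real.exp_pos _).le, ← Real.exp_add]
        congr 3
        rw [Finset.sum_neg_distrib]
        ring_nf
    _ = ∏ i, ENNReal.ofReal (Real.Gamma (α i)) := by
        have h : Measurable fun y : Fin m → ℝ =>
            ∏ j, posPow (α j.castSucc) (y j) * ENNReal.ofReal (Real.exp (-y j)) :=
          Finset.measurable_fun_prod _ fun j _ => (hf _).comp (measurable_pi_apply j)
        rw [lintegral_mul_const _ h,
          lintegral_fin_prod_eq_prod (fun j u => posPow (α j.castSucc) u * ENNReal.ofReal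
            (Real.exp (-u))) fun j => hf _, Fin.prod_univ_castSucc]
        simp only [lintegral_posPow_mul_exp (hα _)]

end MomentEst

/-! ### Moments of the Dirichlet distribution -/

namespace MomentEst

variable {k : ℕ}

lemma completeSimplex_eq_snoc {m : ℕ} (y : Fin m → ℝ) :
    completeSimplex (k := m + 1) y = Fin.snoc (α := fun _ => ℝ) y (1 - ∑ j, y j) := by
  ext i
  refine Fin.lastCases ?_ (fun j => ?_) i
  · simp [completeSimplex]
  · simp [completeSimplex]

lemma sum_completeSimplex (hk : 2 ≤ k) (y : Fin (k - 1) → ℝ) : ∑ i, completeSimplex y i = 1 := by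
  obtain ⟨m, rfl⟩ : ∃ m, k = m + 1 := ⟨k - 1, by omega⟩
  rw [completeSimplex_eq_snoc, Fin.sum_univ_castSucc]
  simp

/-- With at least two coordinates, another positive coordinate forces each one below 1. -/
lemma mem_openSimplex_iff (hk : 2 ≤ k) {x : Fin k → ℝ} (hx : ∑ i, x i = 1) :
    x ∈ openSimplex k ↔ ∀ i, 0 < x i := by
  refine ⟨fun h i => (h.1 i).1, fun h => ⟨fun i => ⟨h i, ?_⟩, hx⟩⟩
  obtain ⟨j, hj⟩ : ∃ j : Fin k, j ≠ i :=
    haveI : Nontrivial (Fin k) := Fin.nontrivial_iff_two_le.2 hk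
    exists_ne i
  rw [← hx]
  exact Finset.single_lt_sum hj (Finset.mem_univ i) (Finset.mem_univ j) (h j)
    fun l _ _ => (h l).le

lemma measurableSet_openSimplex : MeasurableSet (openSimplex k) := by
  have : openSimplex k = (⋂ i, (fun x : Fin k → ℝ => x i) ⁻¹' Set.Ioo 0 1)
      ∩ {x | ∑ i, x i = 1} := by
    ext x
    simp [openSimplex]
  rw [this]
  refine (MeasurableSet.iInter fun i => measurable_pi_apply i measurableSet_Ioo).inter ?_
  exact measurableSet_eq_fun (by fun_prop) measurable_const

lemma sum_pos_of_mem_posOrthant (hk : 2 ≤ k) {α : Fin k → ℝ} (hα : α ∈ posOrthant k) :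
    0 < ∑ i, α i :=
  haveI : Nonempty (Fin k) := ⟨⟨0, by omega⟩⟩
  Finset.sum_pos (fun i _ => hα i) Finset.univ_nonempty

/-- The normalizing constant of the Dirichlet density. -/
noncomputable def dirichletConst (α : Fin k → ℝ) : ℝ :=
  Real.Gamma (∑ i, α i) / ∏ i, Real.Gamma (α i)

lemma dirichletConst_pos (hk : 2 ≤ k) {α : Fin k → ℝ} (hα : α ∈ posOrthant k) :
    0 < dirichletConst α :=
  div_pos (Real.Gamma_pos_of_pos (sum_pos_of_mem_posOrthant hk hα))
    (Finset.prod_pos fun i _ => Real.Gamma_pos_of_pos (hα i))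

lemma dirichletPDF_completeSimplex (hk : 2 ≤ k) {α : Fin k → ℝ} (hα : α ∈ posOrthant k)
    (y : Fin (k - 1) → ℝ) :
    dirichletPDF α (completeSimplex y)
      = ENNReal.ofReal (dirichletConst α) * ∏ i, posPow (α i) (completeSimplex y i) := by
  unfold dirichletPDF
  by_cases h : ∀ i, 0 < completeSimplex y i
  · rw [Set.indicator_of_mem ((mem_openSimplex_iff hk (sum_completeSimplex hk y)).2 h),
      prod_posPow_of_pos α h, ← ENNReal.ofReal_mul (dirichletConst_pos hk hα).le, dirichletConst]
  · rw [Set.indicator_of_notMem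
      (mt (mem_openSimplex_iff hk (sum_completeSimplex hk y)).1 h)]
    push Not at h
    obtain ⟨i, hi⟩ := h
    rw [prod_posPow_of_nonpos α hi, mul_zero]

lemma lintegral_prod_posPow_completeSimplex (hk : 2 ≤ k) {α : Fin k → ℝ} (hα : α ∈ posOrthant k) :
    ∫⁻ y : Fin (k - 1) → ℝ, ∏ i, posPow (α i) (completeSimplex y i)
      = ENNReal.ofReal (dirichletConst α)⁻¹ := by
  obtain ⟨m, rfl⟩ : ∃ m, k = m + 1 := ⟨k - 1, by omega⟩
  have hΓ := Real.Gamma_pos_of_pos (sum_pos_of_mem_posOrthant hk hα)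
  have h := Gamma_mul_lintegral_prod_posPow hα
  rw [← ENNReal.ofReal_prod_of_nonneg fun i _ => (Real.Gamma_pos_of_pos (hα i)).le] at h
  have h2 : ∫⁻ y : Fin (m + 1 - 1) → ℝ, ∏ i, posPow (α i) (completeSimplex (k := m + 1) y i)
      = ∫⁻ y : Fin m → ℝ, ∏ i, posPow (α i) (Fin.snoc (α := fun _ => ℝ) y (1 - ∑ j, y j) i) :=
    lintegral_congr fun y => congrArg (fun x : Fin (m + 1) → ℝ => ∏ i, posPow (α i) (x i))
      (completeSimplex_eq_snoc y)
  rw [h2, dirichletConst, inv_div, ENNReal.ofReal_div_of_pos hΓ, ← h, mul_comm,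
    ENNReal.mul_div_cancel_right (by simpa using hΓ) ENNReal.ofReal_ne_top]

lemma measurable_prod_posPow (α : Fin k → ℝ) :
    Measurable fun x : Fin k → ℝ => ∏ i, posPow (α i) (x i) :=
  Finset.measurable_fun_prod _ fun i _ => (measurable_posPow _).comp (measurable_pi_apply i)

lemma lintegral_dirichletMeasure (hk : 2 ≤ k) {α : Fin k → ℝ} (hα : α ∈ posOrthant k)
    {f : (Fin k → ℝ) → ENNReal} (hf : Measurable f) :
    ∫⁻ x, f x ∂(dirichletMeasure α) = ENNReal.ofReal (dirichletConst α)
      * ∫⁻ y : Fin (k - 1) → ℝ, (∏ i, posPow (α i) (completeSimplex y i)) * f (completeSimplex y) := by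
  have hm : Measurable fun y : Fin (k - 1) → ℝ => ∏ i, posPow (α i) (completeSimplex y i) :=
    (measurable_prod_posPow α).comp measurable_completeSimplex
  have hfm : Measurable fun y : Fin (k - 1) → ℝ => f (completeSimplex y) :=
    hf.comp measurable_completeSimplex
  rw [dirichletMeasure, lintegral_map hf measurable_completeSimplex]
  simp only [dirichletPDF_completeSimplex hk hα]
  rw [lintegral_withDensity_eq_lintegral_mul _ (hm.const_mul _) hfm,
    ← lintegral_const_mul (f := fun y : Fin (k - 1) → ℝ => (∏ i, posPow (α i)
      (completeSimplex y i)) * f (completeSimplex y)) _ (hm.mul hfm)]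
  exact lintegral_congr fun y => by simp only [Pi.mul_apply, mul_assoc]

lemma isProbabilityMeasure_dirichletMeasure (hk : 2 ≤ k) {α : Fin k → ℝ} (hα : α ∈ posOrthant k) :
    IsProbabilityMeasure (dirichletMeasure α) := by
  refine ⟨?_⟩
  have h := dirichletConst_pos hk hα
  rw [← lintegral_one, lintegral_dirichletMeasure hk hα measurable_const]
  simp only [mul_one]
  rw [lintegral_prod_posPow_completeSimplex hk hα, ← ENNReal.ofReal_mul h.le,
    mul_inv_cancel₀ h.ne', ENNReal.ofReal_one]

lemma dirichletMeasure_compl_openSimplex (hk : 2 ≤ k) {α : Fin k → ℝ} (hα : α ∈ posOrthant k) :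
    dirichletMeasure α (openSimplex k)ᶜ = 0 := by
  have hs := (measurableSet_openSimplex (k := k)).compl
  rw [← lintegral_indicator_one hs,
    lintegral_dirichletMeasure hk hα (measurable_one.indicator hs)]
  refine mul_eq_zero_of_right _ ((lintegral_congr fun y => ?_).trans lintegral_zero)
  by_cases h : ∀ i, 0 < completeSimplex y i
  · rw [Set.indicator_of_notMem, mul_zero]
    simpa using (mem_openSimplex_iff hk (sum_completeSimplex hk y)).2 h
  · push Not at h
    obtain ⟨i, hi⟩ := h
    rw [prod_posPow_of_nonpos α hi, zero_mul]

lemma ae_mem_openSimplex (hk : 2 ≤ k) {α : Fin k → ℝ} (hα : α ∈ posOrthant k) :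
    ∀ᵐ x ∂(dirichletMeasure α), x ∈ openSimplex k :=
  dirichletMeasure_compl_openSimplex hk hα

/-- Exponential tilting by log x_j stays inside the Dirichlet family. Where x_j ≤ 0 both sides
vanish, so the value of `Real.log` there is irrelevant. -/
lemma prod_posPow_mul_exp_log (α x : Fin k → ℝ) (j : Fin k) (s : ℝ) :
    (∏ i, posPow (α i) (x i)) * ENNReal.ofReal (Real.exp (s * Real.log (x j)))
      = ∏ i, posPow (Function.update α j (α j + s) i) (x i) := by
  have h : posPow (α j) (x j) * ENNReal.ofReal (Real.exp (s * Real.log (x j)))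
      = posPow (α j + s) (x j) := by
    rcases lt_or_ge 0 (x j) with h | h
    · rw [posPow_of_pos h, posPow_of_pos h, mul_comm s, ← Real.rpow_def_of_pos h,
        ← ENNReal.ofReal_mul (by positivity), ← Real.rpow_add h]
      ring_nf
    · rw [posPow_of_nonpos h, posPow_of_nonpos h, zero_mul]
  rw [← Finset.mul_prod_erase _ _ (Finset.mem_univ j),
    ← Finset.mul_prod_erase Finset.univ _ (Finset.mem_univ j), Function.update_self, ← h,
    mul_right_comm]
  congr 1
  exact Finset.prod_congr rfl fun i hi => by
    rw [Function.update_of_ne (Finset.ne_of_mem_erase hi)]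

lemma dirichletConst_update {α : Fin k → ℝ} (hα : α ∈ posOrthant k) (j : Fin k)
    {s : ℝ} (hs : 0 < α j + s) :
    dirichletConst α * (dirichletConst (Function.update α j (α j + s)))⁻¹
      = Real.Gamma (∑ i, α i) / Real.Gamma (α j)
        * (Real.Gamma (α j + s) / Real.Gamma (∑ i, α i + s)) := by
  have hsum : ∑ i, Function.update α j (α j + s) i = ∑ i, α i + s := by
    rw [← Finset.add_sum_erase Finset.univ α (Finset.mem_univ j),
      ← Finset.add_sum_erase _ _ (Finset.mem_univ j), Function.update_self,
      Finset.sum_congr rfl fun i hi => Function.update_of_ne (Finset.ne_of_mem_erase hi) _ _]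
    ring
  have hprod : ∏ i, Real.Gamma (Function.update α j (α j + s) i)
      = Real.Gamma (α j + s) * ∏ i ∈ Finset.univ.erase j, Real.Gamma (α i) := by
    rw [← Finset.mul_prod_erase _ _ (Finset.mem_univ j), Function.update_self]
    congr 1
    exact Finset.prod_congr rfl fun i hi => by
      rw [Function.update_of_ne (Finset.ne_of_mem_erase hi)]
  have h1 : Real.Gamma (α j) ≠ 0 := (Real.Gamma_pos_of_pos (hα j)).ne'
  have h3 : ∏ i ∈ Finset.univ.erase j, Real.Gamma (α i) ≠ 0 :=
    (Finset.prod_pos fun i _ => Real.Gamma_pos_of_pos (hα i)).ne'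
  rw [dirichletConst, dirichletConst, hsum, hprod,
    ← Finset.mul_prod_erase _ _ (Finset.mem_univ j)]
  field_simp

lemma update_mem_posOrthant {α : Fin k → ℝ} (hα : α ∈ posOrthant k) (j : Fin k)
    {s : ℝ} (hs : 0 < α j + s) : Function.update α j (α j + s) ∈ posOrthant k := by
  intro i
  rcases eq_or_ne i j with rfl | h
  · simpa using hs
  · rw [Function.update_of_ne h]
    exact hα i

lemma lintegral_exp_log_dirichletMeasure (hk : 2 ≤ k) {α : Fin k → ℝ} (hα : α ∈ posOrthant k)
    (j : Fin k) {s : ℝ} (hs : 0 < α j + s) :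
    ∫⁻ x, ENNReal.ofReal (Real.exp (s * Real.log (x j))) ∂(dirichletMeasure α)
      = ENNReal.ofReal (Real.Gamma (∑ i, α i) / Real.Gamma (α j)
        * (Real.Gamma (α j + s) / Real.Gamma (∑ i, α i + s))) := by
  rw [lintegral_dirichletMeasure hk hα (by fun_prop)]
  simp only [prod_posPow_mul_exp_log]
  rw [lintegral_prod_posPow_completeSimplex hk (update_mem_posOrthant hα j hs),
    ← ENNReal.ofReal_mul (dirichletConst_pos hk hα).le, dirichletConst_update hα j hs]

lemma mem_integrableExpSet_log (hk : 2 ≤ k) {α : Fin k → ℝ} (hα : α ∈ posOrthant k)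
    (j : Fin k) {s : ℝ} (hs : 0 < α j + s) :
    s ∈ integrableExpSet (fun x : Fin k → ℝ => Real.log (x j)) (dirichletMeasure α) := by
  refine ⟨Measurable.aestronglyMeasurable (by fun_prop), ?_⟩
  rw [hasFiniteIntegral_iff_ofReal (ae_of_all _ fun x => (Real.exp_pos _).le),
    lintegral_exp_log_dirichletMeasure hk hα j hs]
  exact ENNReal.ofReal_lt_top

/-- The half-line s > -α_j is open, so it lies in the interior. This gives moments of all orders of
log X_j (at s = 0) and differentiability of its moment generating function. -/
lemma mem_interior_integrableExpSet_log (hk : 2 ≤ k) {α : Fin k → ℝ} (hα : α ∈ posOrthant k)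
    (j : Fin k) {s : ℝ} (hs : 0 < α j + s) :
    s ∈ interior (integrableExpSet (fun x : Fin k → ℝ => Real.log (x j)) (dirichletMeasure α)) := by
  refine mem_interior.2 ⟨Set.Ioi (-α j), fun t ht => ?_, isOpen_Ioi, ?_⟩
  · exact mem_integrableExpSet_log hk hα j (by linarith [Set.mem_Ioi.1 ht])
  · exact Set.mem_Ioi.2 (by linarith)

lemma mgf_log_dirichletMeasure (hk : 2 ≤ k) {α : Fin k → ℝ} (hα : α ∈ posOrthant k)
    (j : Fin k) {s : ℝ} (hs : 0 < α j + s) :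
    mgf (fun x : Fin k → ℝ => Real.log (x j)) (dirichletMeasure α) s
      = Real.Gamma (∑ i, α i) / Real.Gamma (α j)
        * (Real.Gamma (α j + s) / Real.Gamma (∑ i, α i + s)) := by
  have h0 := sum_pos_of_mem_posOrthant hk hα
  have hle : α j ≤ ∑ i, α i := Finset.single_le_sum (fun i _ => (hα i).le) (Finset.mem_univ j)
  have h1 := Real.Gamma_pos_of_pos h0
  have h2 := Real.Gamma_pos_of_pos (hα j)
  have h3 := Real.Gamma_pos_of_pos hs
  have h4 := Real.Gamma_pos_of_pos (by linarith : 0 < ∑ i, α i + s)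
  rw [mgf, integral_eq_lintegral_of_nonneg_ae (ae_of_all _ fun x => (Real.exp_pos _).le)
    (Measurable.aestronglyMeasurable (by fun_prop)),
    lintegral_exp_log_dirichletMeasure hk hα j hs, ENNReal.toReal_ofReal (by positivity)]

/-! ### The digamma function -/

lemma hasDerivAt_log_Gamma {a : ℝ} (ha : 0 < a) :
    HasDerivAt (fun t => Real.log (Real.Gamma t)) (digamma a) a :=
  ((Real.differentiableAt_Gamma fun m => by
    have : (0 : ℝ) ≤ m := m.cast_nonneg
    linarith).log (Real.Gamma_pos_of_pos ha).ne').hasDerivAt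

lemma hasDerivAt_Gamma {a : ℝ} (ha : 0 < a) :
    HasDerivAt Real.Gamma (Real.Gamma a * digamma a) a := by
  have h := (hasDerivAt_log_Gamma ha).exp
  rw [Real.exp_log (Real.Gamma_pos_of_pos ha)] at h
  refine h.congr_of_eventuallyEq ?_
  filter_upwards [lt_mem_nhds ha] with t ht
  rw [Real.exp_log (Real.Gamma_pos_of_pos ht)]

/-- Differentiate log Γ(t+1) = log t + log Γ(t). -/
lemma digamma_add_one {a : ℝ} (ha : 0 < a) : digamma (a + 1) = digamma a + a⁻¹ := by
  have h1 : HasDerivAt (fun t => Real.log (Real.Gamma (t + 1))) (digamma (a + 1)) a :=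
    (hasDerivAt_log_Gamma (by linarith : 0 < a + 1)).comp_add_const a 1
  have h2 := (Real.hasDerivAt_log ha.ne').add (hasDerivAt_log_Gamma ha)
  rw [add_comm (digamma a)]
  refine h1.unique (h2.congr_of_eventuallyEq ?_)
  filter_upwards [lt_mem_nhds ha] with t ht
  rw [Real.Gamma_add_one ht.ne', Real.log_mul ht.ne' (Real.Gamma_pos_of_pos ht).ne']
  rfl

/-! ### The moments in the score-adjusted moment estimator -/

/-- The derivative of the moment generating function of log X_j, computed both under the integral
and from the Gamma formula. Taking s = 0 yields E[log X_j], and s = 1 yields E[X_j log X_j]. -/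
lemma integral_log_mul_exp_log_dirichletMeasure (hk : 2 ≤ k) {α : Fin k → ℝ}
    (hα : α ∈ posOrthant k) (j : Fin k) {s : ℝ} (hs : 0 ≤ s) :
    ∫ x, Real.log (x j) * Real.exp (s * Real.log (x j)) ∂(dirichletMeasure α)
      = Real.Gamma (∑ i, α i) / Real.Gamma (α j)
        * (Real.Gamma (α j + s) / Real.Gamma (∑ i, α i + s))
        * digammaDiff (α j + s) (∑ i, α i + s) := by
  have h0 := sum_pos_of_mem_posOrthant hk hα
  have hs' : 0 < α j + s := by linarith [hα j]
  have hs0 : 0 < ∑ i, α i + s := by linarith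
  have hd := hasDerivAt_mgf (mem_interior_integrableExpSet_log hk hα j hs')
  have h1 : HasDerivAt (fun t => Real.Gamma (α j + t)) _ s :=
    (hasDerivAt_Gamma hs').comp_const_add (α j) s
  have h2 : HasDerivAt (fun t => Real.Gamma (∑ i, α i + t)) _ s :=
    (hasDerivAt_Gamma hs0).comp_const_add (∑ i, α i) s
  have hΓ := (Real.Gamma_pos_of_pos hs0).ne'
  have h3 := (h1.div h2 hΓ).const_mul (Real.Gamma (∑ i, α i) / Real.Gamma (α j))
  have h4 : (mgf (fun x : Fin k → ℝ => Real.log (x j)) (dirichletMeasure α)) =ᶠ[𝓝 s]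
      fun t => Real.Gamma (∑ i, α i) / Real.Gamma (α j)
        * (Real.Gamma (α j + t) / Real.Gamma (∑ i, α i + t)) := by
    filter_upwards [lt_mem_nhds (by linarith : -α j < s)] with t ht
    exact mgf_log_dirichletMeasure hk hα j (by linarith)
  rw [hd.unique (h3.congr_of_eventuallyEq h4), digammaDiff]
  field_simp

lemma integral_log_dirichletMeasure (hk : 2 ≤ k) {α : Fin k → ℝ} (hα : α ∈ posOrthant k)
    (j : Fin k) :
    ∫ x, Real.log (x j) ∂(dirichletMeasure α) = digammaDiff (α j) (∑ i, α i) := by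
  have h := integral_log_mul_exp_log_dirichletMeasure hk hα j le_rfl
  have h1 := (Real.Gamma_pos_of_pos (hα j)).ne'
  have h2 := (Real.Gamma_pos_of_pos (sum_pos_of_mem_posOrthant hk hα)).ne'
  simp only [zero_mul, Real.exp_zero, mul_one, add_zero] at h
  rw [h]
  field_simp

lemma exp_log_ae_eq (hk : 2 ≤ k) {α : Fin k → ℝ} (hα : α ∈ posOrthant k) (j : Fin k) :
    (fun x : Fin k → ℝ => Real.exp (1 * Real.log (x j))) =ᵐ[dirichletMeasure α] fun x => x j := by
  filter_upwards [ae_mem_openSimplex hk hα] with x hx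
  rw [one_mul, Real.exp_log (hx.1 j).1]

lemma integral_eval_dirichletMeasure (hk : 2 ≤ k) {α : Fin k → ℝ} (hα : α ∈ posOrthant k)
    (j : Fin k) : ∫ x, x j ∂(dirichletMeasure α) = α j / ∑ i, α i := by
  have hj := hα j
  have h0 := sum_pos_of_mem_posOrthant hk hα
  have h := mgf_log_dirichletMeasure hk hα j (s := 1) (by linarith)
  have h1 := (Real.Gamma_pos_of_pos (hα j)).ne'
  have h2 := (Real.Gamma_pos_of_pos h0).ne'
  rw [mgf, integral_congr_ae (exp_log_ae_eq hk hα j), Real.Gamma_add_one hj.ne',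
    Real.Gamma_add_one h0.ne'] at h
  rw [h]
  field_simp

lemma integral_mul_log_dirichletMeasure (hk : 2 ≤ k) {α : Fin k → ℝ} (hα : α ∈ posOrthant k)
    (j : Fin k) :
    ∫ x, x j * Real.log (x j) ∂(dirichletMeasure α)
      = α j / (∑ i, α i) * (digammaDiff (α j) (∑ i, α i) + (α j)⁻¹ - (∑ i, α i)⁻¹) := by
  have hj := hα j
  have h0 := sum_pos_of_mem_posOrthant hk hα
  have h := integral_log_mul_exp_log_dirichletMeasure hk hα j (s := 1) zero_le_one
  have h1 := (Real.Gamma_pos_of_pos (hα j)).ne'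
  have h2 := (Real.Gamma_pos_of_pos h0).ne'
  have hae : (fun x : Fin k → ℝ => Real.log (x j) * Real.exp (1 * Real.log (x j)))
      =ᵐ[dirichletMeasure α] fun x => x j * Real.log (x j) := by
    filter_upwards [exp_log_ae_eq hk hα j] with x hx
    rw [hx, mul_comm]
  rw [integral_congr_ae hae, Real.Gamma_add_one hj.ne', Real.Gamma_add_one h0.ne', digammaDiff,
    digamma_add_one hj, digamma_add_one h0] at h
  rw [h, digammaDiff]
  field_simp
  ring

end MomentEst

/-! ### The score-adjusted moment estimator -/

namespace MomentEst

variable {k : ℕ}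

lemma measurable_sameH : Measurable (sameH (k := k)) := by
  refine measurable_pi_lambda _ fun a => ?_
  rcases a with i | i | i <;> simp only [sameH, Sum.elim_inl, Sum.elim_inr] <;> fun_prop

lemma measurable_sameG : Measurable (sameG (k := k)) := by
  unfold sameG
  fun_prop

lemma sameEstimator_eq (n : ℕ) (x : Fin n → Fin k → ℝ) :
    sameEstimator n x = sameG (sampleMean fun t => sameH (x t)) := by
  ext i
  simp [sameEstimator, sameG, sampleMean, sameH, Finset.sum_apply]

lemma memLp_sameH (hk : 2 ≤ k) {α : Fin k → ℝ} (hα : α ∈ posOrthant k) :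
    MemLp (sameH (k := k)) 2 (dirichletMeasure α) := by
  have := isProbabilityMeasure_dirichletMeasure hk hα
  have hlog : ∀ j, MemLp (fun x : Fin k → ℝ => Real.log (x j)) 2 (dirichletMeasure α) := fun j =>
    memLp_of_mem_interior_integrableExpSet
      (mem_interior_integrableExpSet_log hk hα j (by simpa using hα j)) 2
  refine memLp_pi_iff.2 fun a => ?_
  rcases a with i | i | i
  · refine MemLp.of_bound (measurable_pi_apply i).aestronglyMeasurable 1 ?_
    filter_upwards [ae_mem_openSimplex hk hα] with x hx
    simpa [sameH, abs_of_pos (hx.1 i).1] using (hx.1 i).2.le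
  · exact hlog i
  -- Since 0 < x_i < 1, |x_i log x_i| is dominated by |log x_i|.
  · refine (hlog i).mono (Measurable.aestronglyMeasurable (by simp only [sameH, Sum.elim_inr]; fun_prop)) ?_
    filter_upwards [ae_mem_openSimplex hk hα] with x hx
    simp only [sameH, Sum.elim_inr, norm_mul]
    refine mul_le_of_le_one_left (norm_nonneg _) ?_
    rw [Real.norm_of_nonneg (hx.1 i).1.le]
    exact (hx.1 i).2.le

lemma integrable_sameH (hk : 2 ≤ k) {α : Fin k → ℝ} (hα : α ∈ posOrthant k) :
    Integrable (sameH (k := k)) (dirichletMeasure α) :=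
  have := isProbabilityMeasure_dirichletMeasure hk hα
  (memLp_sameH hk hα).integrable (by norm_num)

lemma momentMap_sameH (hk : 2 ≤ k) {α : Fin k → ℝ} (hα : α ∈ posOrthant k) :
    momentMap dirichletMeasure sameH α = Sum.elim (fun j => α j / ∑ i, α i)
      (Sum.elim (fun j => digammaDiff (α j) (∑ i, α i))
        fun j => α j / (∑ i, α i) * (digammaDiff (α j) (∑ i, α i) + (α j)⁻¹ - (∑ i, α i)⁻¹)) := by
  ext a
  rw [momentMap, eval_integral fun a => integrable_pi_iff.1 (integrable_sameH hk hα) a]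
  rcases a with j | j | j
  · exact integral_eval_dirichletMeasure hk hα j
  · exact integral_log_dirichletMeasure hk hα j
  · exact integral_mul_log_dirichletMeasure hk hα j

/-- The denominator of `sameG`. -/
def sameDenom (y : Fin k ⊕ Fin k ⊕ Fin k → ℝ) : ℝ :=
  ∑ j, (y (.inr (.inr j)) - y (.inl j) * y (.inr (.inl j)))

lemma sameDenom_momentMap (hk : 2 ≤ k) {α : Fin k → ℝ} (hα : α ∈ posOrthant k) :
    sameDenom (momentMap dirichletMeasure sameH α) = ((k : ℝ) - 1) / ∑ i, α i := by
  have h0 := sum_pos_of_mem_posOrthant hk hα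
  rw [momentMap_sameH hk hα]
  simp only [sameDenom, Sum.elim_inl, Sum.elim_inr]
  -- Each summand is Cov(X_j, log X_j); the terms Ψ(α_j, α₀) cancel.
  calc _ = ∑ j, ((∑ i, α i)⁻¹ - α j / (∑ i, α i) ^ 2) := by
        refine Finset.sum_congr rfl fun j _ => ?_
        have := (hα j).ne'
        field_simp
        ring
    _ = _ := by
        rw [Finset.sum_sub_distrib, ← Finset.sum_div]
        simp only [Finset.sum_const, Finset.card_univ, Fintype.card_fin, nsmul_eq_mul]
        field_simp

lemma natCast_sub_one_pos (hk : 2 ≤ k) : (0 : ℝ) < (k : ℝ) - 1 := by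
  have : (2 : ℝ) ≤ k := by exact_mod_cast hk
  linarith

lemma sameG_momentMap (hk : 2 ≤ k) {α : Fin k → ℝ} (hα : α ∈ posOrthant k) :
    sameG (momentMap dirichletMeasure sameH α) = α := by
  ext i
  have h0 := sum_pos_of_mem_posOrthant hk hα
  have hk1 := (natCast_sub_one_pos hk).ne'
  have h := sameDenom_momentMap hk hα
  rw [sameDenom] at h
  rw [sameG, h, momentMap_sameH hk hα]
  simp only [Sum.elim_inl]
  field_simp

lemma isMomentTypeEstimator_sameEstimator (hk : 2 ≤ k) :
    IsMomentTypeEstimator (posOrthant k) (openSimplex k) dirichletMeasure sameH sameG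
      sameEstimator where
  isProbabilityMeasure _ hθ := isProbabilityMeasure_dirichletMeasure hk hθ
  measure_compl_support _ hθ := dirichletMeasure_compl_openSimplex hk hθ
  integrable _ hθ := integrable_sameH hk hθ
  injOn := Set.LeftInvOn.injOn (f₁' := sameG) fun _ hθ => sameG_momentMap hk hθ
  leftInvOn _ hθ := sameG_momentMap hk hθ
  estimator_eq n _ x _ := sameEstimator_eq n x

/-! ### Smoothness of g and its Jacobian at μ -/

lemma contDiffAt_sameG {y : Fin k ⊕ Fin k ⊕ Fin k → ℝ} (hy : sameDenom y ≠ 0) :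
    ContDiffAt ℝ 1 (sameG (k := k)) y := by
  refine contDiffAt_pi.2 fun i => ContDiffAt.div ?_ ?_ hy <;> fun_prop

lemma hasFDerivAt_sameG (hk : 2 ≤ k) {α : Fin k → ℝ} (hα : α ∈ posOrthant k) :
    HasFDerivAt sameG (Matrix.mulVecLin (sameJacobian α)).toContinuousLinearMap
      (momentMap dirichletMeasure sameH α) := by
  have h0 := sum_pos_of_mem_posOrthant hk hα
  have hk1 := (natCast_sub_one_pos hk).ne'
  have hden := sameDenom_momentMap hk hα
  have hne : sameDenom (momentMap dirichletMeasure sameH α) ≠ 0 := by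
    rw [hden]
    exact div_ne_zero hk1 h0.ne'
  set μ := momentMap dirichletMeasure sameH α with hμ
  have hp : ∀ a : Fin k ⊕ Fin k ⊕ Fin k, HasFDerivAt (fun y : Fin k ⊕ Fin k ⊕ Fin k → ℝ => y a)
      (ContinuousLinearMap.proj (R := ℝ) (φ := fun _ => ℝ) a) μ := fun a => hasFDerivAt_apply a μ
  have hD : HasFDerivAt (sameDenom (k := k)) _ μ :=
    HasFDerivAt.fun_sum (u := Finset.univ) fun j _ =>
      (hp (.inr (.inr j))).sub ((hp (.inl j)).mul (hp (.inr (.inl j))))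
  refine hasFDerivAt_pi'.2 fun i => ?_
  have hg := ((hp (.inl i)).const_mul ((k : ℝ) - 1)).mul
    ((hasDerivAt_inv hne).comp_hasFDerivAt μ hD)
  refine (hg.congr_of_eventuallyEq (.of_forall fun y => div_eq_mul_inv _ _)).congr_fderiv ?_
  ext v
  have e1 : ∀ j, μ (.inl j) = α j / ∑ l, α l := fun j => by rw [hμ, momentMap_sameH hk hα]; rfl
  have e2 : ∀ j, μ (.inr (.inl j)) = digammaDiff (α j) (∑ l, α l) := fun j => by
    rw [hμ, momentMap_sameH hk hα]; rfl
  set A := ∑ l, α l with hA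
  -- The quotient rule with denominator D = (k-1)/α₀: dg_i = α₀ v_i - (α₀ α_i/(k-1)) dD, where the
  -- sum below is dD(v).
  have hR : (sameJacobian α).mulVec v i = A * v (.inl i) - A * α i / ((k : ℝ) - 1)
      * ∑ j, (v (.inr (.inr j)) - (α j / A * v (.inr (.inl j))
        + digammaDiff (α j) A * v (.inl j))) := by
    simp only [sameJacobian, Matrix.mulVec, dotProduct, Fintype.sum_sum_type,
      Matrix.fromCols_apply_inl, Matrix.fromCols_apply_inr, Matrix.of_apply, add_mul,
      Finset.sum_add_distrib, ite_mul, zero_mul, Finset.sum_ite_eq, Finset.mem_univ, if_true,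
      Finset.mul_sum, ← hA]
    rw [add_right_comm, ← Finset.sum_add_distrib, ← Finset.sum_add_distrib, add_comm,
      sub_eq_add_neg (A * v (.inl i)), ← Finset.sum_neg_distrib]
    congr 1
    refine Finset.sum_congr rfl fun j _ => ?_
    field_simp
    ring
  simp [hden, e1, e2, hR]
  field_simp
  ring

end MomentEst

/-! ### Consistency and asymptotic normality -/

namespace MomentEst

variable {k : ℕ}

lemma isOpen_posOrthant : IsOpen (posOrthant k) := by
  have : posOrthant k = ⋂ i, {α : Fin k → ℝ | 0 < α i} := by
    ext α
    simp [posOrthant]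
  rw [this]
  exact isOpen_iInter_of_finite fun i => isOpen_lt continuous_const (continuous_apply i)

section Asymptotics

variable {Ω : Type*} [MeasurableSpace Ω] {P : Measure Ω}

variable {X : ℕ → Ω → Fin k → ℝ} {α : Fin k → ℝ}

lemma sampleMean_eq_sum_range {E : Type*} [AddCommGroup E] [Module ℝ E] (x : ℕ → E) (n : ℕ) :
    sampleMean (fun t : Fin n => x t) = (n : ℝ)⁻¹ • ∑ t ∈ Finset.range n, x t := by
  rw [sampleMean, Finset.sum_range]

lemma aemeasurable_sampleMean_sameH (hlaw : ∀ t, HasLaw (X t) (dirichletMeasure α) P) (n : ℕ) :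
    AEMeasurable (fun ω => sampleMean fun t : Fin n => sameH (X t ω)) P := by
  have h : ∀ t, AEMeasurable (fun ω => sameH (X t ω)) P := fun t =>
    measurable_sameH.comp_aemeasurable (hlaw t).aemeasurable
  exact (Finset.aemeasurable_fun_sum Finset.univ fun (t : Fin n) _ => h t).const_smul (n : ℝ)⁻¹

lemma identDistrib_sameH (hlaw : ∀ t, HasLaw (X t) (dirichletMeasure α) P) (t : ℕ) :
    IdentDistrib (fun ω => sameH (X t ω)) (fun ω => sameH (X 0 ω)) P P :=
  (show IdentDistrib (X t) (X 0) P P from ⟨(hlaw t).aemeasurable, (hlaw 0).aemeasurable,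
    (hlaw t).map_eq.trans (hlaw 0).map_eq.symm⟩).comp measurable_sameH

lemma integral_sameH (hlaw : ∀ t, HasLaw (X t) (dirichletMeasure α) P) :
    ∫ ω, sameH (X 0 ω) ∂P = momentMap dirichletMeasure sameH α := by
  rw [momentMap, ← (hlaw 0).map_eq, integral_map (hlaw 0).aemeasurable
    measurable_sameH.aestronglyMeasurable]

lemma memLp_sameH_comp (hk : 2 ≤ k) (hα : α ∈ posOrthant k)
    (hlaw : ∀ t, HasLaw (X t) (dirichletMeasure α) P) :
    MemLp (fun ω => sameH (X 0 ω)) 2 P := by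
  have h := memLp_sameH hk hα
  rw [← (hlaw 0).map_eq] at h
  exact h.comp_of_map (hlaw 0).aemeasurable

variable [IsProbabilityMeasure P]

/-- A sequence of random elements that converges almost surely to a point of an open set belongs to
this set with probability tending to one. -/
lemma tendsto_measure_mem_of_ae_tendsto {E : Type*} [PseudoMetricSpace E] [MeasurableSpace E]
    [BorelSpace E] [SecondCountableTopology E] {T : ℕ → Ω → E}
    {c : E} {U : Set E} (hU : IsOpen U) (hc : c ∈ U) (hTm : ∀ n, AEMeasurable (T n) P)
    (hT : ∀ᵐ ω ∂P, Tendsto (fun n => T n ω) atTop (𝓝 c)) :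
    Tendsto (fun n => P {ω | T n ω ∈ U}) atTop (𝓝 1) := by
  obtain ⟨ε, hε, hball⟩ := Metric.isOpen_iff.1 hU c hc
  have h := tendstoInMeasure_iff_dist.1 (tendstoInMeasure_of_tendsto_ae
    (fun n => (hTm n).aestronglyMeasurable) hT) ε hε
  have h1 : Tendsto (fun n => 1 - P {ω | ε ≤ dist (T n ω) c}) atTop (𝓝 1) := by
    simpa using ENNReal.Tendsto.sub tendsto_const_nhds h (Or.inl ENNReal.one_ne_top)
  refine tendsto_of_tendsto_of_tendsto_of_le_of_le h1 tendsto_const_nhds (fun n => ?_)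
    fun n => prob_le_one
  refine tsub_le_iff_right.2 ?_
  rw [← measure_univ (μ := P)]
  refine (measure_mono fun ω _ => ?_).trans (measure_union_le _ _)
  rcases lt_or_ge (dist (T n ω) c) ε with h | h
  · exact Or.inl (hball h)
  · exact Or.inr h

lemma tendsto_sampleMean_sameH (hk : 2 ≤ k) (hα : α ∈ posOrthant k) (hindep : iIndepFun X P)
    (hlaw : ∀ t, HasLaw (X t) (dirichletMeasure α) P) :
    ∀ᵐ ω ∂P, Tendsto (fun n => sampleMean fun t : Fin n => sameH (X t ω)) atTop
      (𝓝 (momentMap dirichletMeasure sameH α)) := by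
  have h := strong_law_ae (μ := P) (fun t ω => sameH (X t ω))
    ((memLp_sameH_comp hk hα hlaw).integrable (by norm_num))
    (fun i j hij => (hindep.indepFun hij).comp measurable_sameH measurable_sameH)
    (identDistrib_sameH hlaw)
  rw [integral_sameH hlaw] at h
  filter_upwards [h] with ω hω
  exact hω.congr fun n => (sampleMean_eq_sum_range (fun t => sameH (X t ω)) n).symm

lemma tendsto_measure_sameEstimator_mem_posOrthant (hk : 2 ≤ k) (hα : α ∈ posOrthant k)
    (hindep : iIndepFun X P) (hlaw : ∀ t, HasLaw (X t) (dirichletMeasure α) P) :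
    Tendsto (fun n : ℕ => P {ω | sameEstimator n (fun t => X t ω) ∈ posOrthant k})
      atTop (𝓝 1) := by
  simp only [sameEstimator_eq]
  refine tendsto_measure_mem_of_ae_tendsto isOpen_posOrthant hα
    (fun n => measurable_sameG.comp_aemeasurable (aemeasurable_sampleMean_sameH hlaw n)) ?_
  filter_upwards [tendsto_sampleMean_sameH hk hα hindep hlaw] with ω hω
  have h := (hasFDerivAt_sameG hk hα).continuousAt.tendsto.comp hω
  rwa [sameG_momentMap hk hα] at h

/-- The central limit theorem for h(X), renormalised from sums to means. The equivalence `L` carries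
h from the sup-normed product to Euclidean space, where the Gaussian lives. -/
lemma tendstoInDistribution_sampleMean_sameH (hk : 2 ≤ k) (hα : α ∈ posOrthant k)
    (hindep : iIndepFun X P) (hlaw : ∀ t, HasLaw (X t) (dirichletMeasure α) P) :
    TendstoInDistribution
      (fun (n : ℕ) ω => √(n : ℝ) • (WithLp.toLp 2 (sampleMean fun t : Fin n => sameH (X t ω))
        - WithLp.toLp 2 (momentMap dirichletMeasure sameH α)))
      atTop (id : EuclideanSpace ℝ (Fin k ⊕ Fin k ⊕ Fin k) → _) (fun _ => P)
      (multivariateGaussian 0 (momentCov dirichletMeasure sameH α)) := by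
  set L := (PiLp.continuousLinearEquiv 2 ℝ fun _ : Fin k ⊕ Fin k ⊕ Fin k => ℝ).symm with hL
  have hLm : Measurable L := L.continuous.measurable
  have hmem := memLp_sameH_comp hk hα hlaw
  have hcov : covMatrix (fun ω => L (sameH (X 0 ω))) P = momentCov dirichletMeasure sameH α := by
    ext a b
    simp only [covMatrix, momentCov, Matrix.of_apply]
    rw [← (hlaw 0).map_eq, covariance_map (by
      exact ((measurable_pi_apply a).comp measurable_sameH).aestronglyMeasurable) (by
      exact ((measurable_pi_apply b).comp measurable_sameH).aestronglyMeasurable)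
      (hlaw 0).aemeasurable]
    rfl
  have h := tendstoInDistribution_inv_sqrt_smul_sum_sub (P := P)
    (Y := fun t ω => L (sameH (X t ω))) (L.toContinuousLinearMap.comp_memLp' hmem)
    (hindep.comp (fun _ x => L (sameH x)) fun _ => hLm.comp measurable_sameH)
    (fun t => (identDistrib_sameH hlaw t).comp hLm)
  rw [hcov] at h
  refine h.congr (fun n => ae_of_all _ fun ω => ?_) (ae_of_all _ fun _ => rfl)
  have hint : ∫ ω, L (sameH (X 0 ω)) ∂P = L (momentMap dirichletMeasure sameH α) := by
    rw [← integral_sameH hlaw]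
    exact L.integral_comp_comm _
  change _ = √(n : ℝ) • (L _ - L _)
  simp only [hint, sampleMean_eq_sum_range (fun t => sameH (X t ω)) n, ← map_sum, ← map_smul,
    ← map_sub]
  congr 1
  -- For n = 0 both scalars are 0; otherwise n^(-1/2) = √n · n⁻¹.
  rcases Nat.eq_zero_or_pos n with rfl | hn
  · simp
  · have hn' : (0 : ℝ) < n := by exact_mod_cast hn
    have h1 : (√(n : ℝ))⁻¹ = √(n : ℝ) * (n : ℝ)⁻¹ := by
      rw [← div_eq_mul_inv, Real.sqrt_div_self']
      simp
    rw [h1, mul_smul, smul_sub (n : ℝ)⁻¹, smul_smul (n : ℝ)⁻¹, inv_mul_cancel₀ hn'.ne', one_smul]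

lemma tendstoInDistribution_sameEstimator (hk : 2 ≤ k) (hα : α ∈ posOrthant k)
    (hindep : iIndepFun X P) (hlaw : ∀ t, HasLaw (X t) (dirichletMeasure α) P) :
    TendstoInDistribution
      (fun (n : ℕ) (ω : Ω) => WithLp.toLp 2
        (√(n : ℝ) • (sameEstimator n (fun t => X t ω) - α)))
      atTop (id : EuclideanSpace ℝ (Fin k) → EuclideanSpace ℝ (Fin k)) (fun _ => P)
      (multivariateGaussian 0 (sameJacobian α * momentCov dirichletMeasure sameH α
        * (sameJacobian α).transpose)) := by
  set L := PiLp.continuousLinearEquiv 2 ℝ fun _ : Fin k ⊕ Fin k ⊕ Fin k => ℝ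
  set M := PiLp.continuousLinearEquiv 2 ℝ fun _ : Fin k => ℝ
  set G := (M.symm.toContinuousLinearMap.comp
    (Matrix.mulVecLin (sameJacobian α)).toContinuousLinearMap).comp L.toContinuousLinearMap
  have hpos : (momentCov dirichletMeasure (sameH (k := k)) α).PosSemidef := by
    have := isProbabilityMeasure_dirichletMeasure hk hα
    exact posSemidef_covMatrix (P := dirichletMeasure α) (Y := fun x => L.symm (sameH x))
      (L.symm.toContinuousLinearMap.comp_memLp' (memLp_sameH hk hα))
  have hG : HasFDerivAt (fun y => M.symm (sameG (L y))) G
      (L.symm (momentMap dirichletMeasure sameH α)) := by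
    have h : HasFDerivAt sameG (Matrix.mulVecLin (sameJacobian α)).toContinuousLinearMap
        (L (L.symm (momentMap dirichletMeasure sameH α))) := by
      rw [L.apply_symm_apply]
      exact hasFDerivAt_sameG hk hα
    exact (M.symm.hasFDerivAt.comp _ h).comp _ L.hasFDerivAt
  have hmeas : Measurable fun y => M.symm (sameG (L y)) :=
    M.symm.continuous.measurable.comp (measurable_sameG.comp L.continuous.measurable)
  have h := tendstoInDistribution_delta_method (fun n => Real.sqrt_nonneg _)
    (tendstoInDistribution_sampleMean_sameH hk hα hindep hlaw)
    (fun n => L.symm.continuous.measurable.comp_aemeasurable (aemeasurable_sampleMean_sameH hlaw n))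
    (by
      filter_upwards [tendsto_sampleMean_sameH hk hα hindep hlaw] with ω hω
      exact (L.symm.continuous.tendsto _).comp hω) hmeas hG
  have hmap := map_multivariateGaussian_zero hpos (sameJacobian α) G fun x => rfl
  have hlim : TendstoInDistribution (fun (n : ℕ) (ω : Ω) => WithLp.toLp 2
        (√(n : ℝ) • (sameEstimator n (fun t => X t ω) - α))) atTop (fun x => G (id x)) (fun _ => P)
      (multivariateGaussian 0 (momentCov dirichletMeasure sameH α)) := by
    refine h.congr (fun n => ae_of_all _ fun ω => ?_) (ae_of_all _ fun _ => rfl)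
    simp only [sameEstimator_eq]
    -- Writing α as g(μ) puts the difference in the form g(T) - g(m) of the delta method.
    conv_rhs => rw [← sameG_momentMap hk hα]
    rfl
  -- Convergence depends only on the law of the limit, so the image under `G` of the Gaussian with
  -- covariance V may be replaced by the identity under the Gaussian with covariance G V Gᵀ.
  refine ⟨hlim.forall_aemeasurable, aemeasurable_id, ?_⟩
  convert! hlim.tendsto using 3
  exact congrArg 𝓝 (Subtype.ext (Measure.map_id.trans hmap.symm))

end Asymptotics

end MomentEst

theorem mainTheorem1 {k : ℕ} (hk : 2 ≤ k)
    (α : Fin k → ℝ) (hα : α ∈ MomentEst.posOrthant k)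
    {Ω : Type*} [MeasurableSpace Ω] (P : Measure Ω) [IsProbabilityMeasure P]
    (X : ℕ → Ω → Fin k → ℝ)
    (hindep : iIndepFun X P)
    (hlaw : ∀ t, HasLaw (X t) (MomentEst.dirichletMeasure α) P) :
    -- it is a moment-type estimator with the functions `h` and `g`
    MomentEst.IsMomentTypeEstimator (MomentEst.posOrthant k) (MomentEst.openSimplex k)
      MomentEst.dirichletMeasure MomentEst.sameH MomentEst.sameG MomentEst.sameEstimator ∧
    -- `h(X)` is square integrable, so that its covariance matrix `V` is well defined
    MemLp MomentEst.sameH 2 (MomentEst.dirichletMeasure α) ∧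
    -- `g` is continuously differentiable at `μ = e_h(α)`, with Jacobian matrix `G`
    ContDiffAt ℝ 1 (MomentEst.sameG (k := k))
      (MomentEst.momentMap MomentEst.dirichletMeasure MomentEst.sameH α) ∧
    HasFDerivAt MomentEst.sameG
      (Matrix.mulVecLin (MomentEst.sameJacobian α)).toContinuousLinearMap
      (MomentEst.momentMap MomentEst.dirichletMeasure MomentEst.sameH α) ∧
    -- the estimator exists with probability tending to one
    Tendsto (fun n : ℕ =>
        P {ω | MomentEst.sameEstimator n (fun t => X t ω) ∈ MomentEst.posOrthant k})
      atTop (𝓝 1) ∧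
    -- asymptotic normality with covariance matrix `G V Gᵀ`
    TendstoInDistribution
      (fun (n : ℕ) (ω : Ω) => WithLp.toLp 2
        (√(n : ℝ) • (MomentEst.sameEstimator n (fun t => X t ω) - α)))
      atTop (id : EuclideanSpace ℝ (Fin k) → EuclideanSpace ℝ (Fin k)) (fun _ => P)
      (multivariateGaussian 0
        (MomentEst.sameJacobian α
          * MomentEst.momentCov MomentEst.dirichletMeasure MomentEst.sameH α
          * (MomentEst.sameJacobian α).transpose)) := by
  exact ⟨MomentEst.isMomentTypeEstimator_sameEstimator hk, MomentEst.memLp_sameH hk hα,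
    MomentEst.contDiffAt_sameG (by
      rw [MomentEst.sameDenom_momentMap hk hα]
      exact div_ne_zero (MomentEst.natCast_sub_one_pos hk).ne'
        (MomentEst.sum_pos_of_mem_posOrthant hk hα).ne'),
    MomentEst.hasFDerivAt_sameG hk hα,
    MomentEst.tendsto_measure_sameEstimator_mem_posOrthant hk hα hindep hlaw,
    MomentEst.tendstoInDistribution_sameEstimator hk hα hindep hlaw⟩
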